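/- Let $X$ (characteristics) and $\Theta$ (states) be Polish spaces with their Borel $\sigma$-fields, let $\phi$ and $\mu$ be Borel probability measures on $X$ and $\Theta$, let $u:X\times\Theta\to\mathbb R$ be bounded and measurable, and let $\alpha\in(0,1)$ and $\lambda>0$. For a Borel probability measure $P$ on $X\times\Theta$ with marginals $P|_\xi$, $P|_\theta$ and disintegrations $P(\cdot\mid\theta)$, $P(\cdot\mid\xi)$, define $$U(P)=\int u\,dP-\alpha\lambda\int_\Theta D_{KL}\big(P(\cdot\mid\theta)\,\|\,\phi\big)\,dP|_\theta(\theta)-(1-\alpha)\lambda\int_X D_{KL}\big(P(\cdot\mid\xi)\,\|\,\mu\big)\,dP|_\xi(\xi)\in[-\infty,\infty),$$ where $D_{KL}(m\|m')=\int\log\frac{dm}{dm'}\,dm$ if $m\ll m'$ and $D_{KL}(m\|m')=\infty$ otherwise. Call $P$ feasible if $P|_\theta=\mu$ and $P|_\xi\ll\phi$, and optimal if it is feasible and maximizes $U$ over all feasible measures. **Theorem.** There is exactly one optimal $P$. In particular the optimal marginal $P|_\xi$ exists and is unique, and the optimal conditional choice probability is unique: a Markov kernel $\kappa$ from $\Theta$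 to $X$ with $P(d\xi,d\theta)=\kappa(\theta,d\xi)\,\mu(d\theta)$ for an optimal $P$ exists, and any two such kernels (for possibly different optimal measures) satisfy $\kappa(\theta,\cdot)=\kappa'(\theta,\cdot)$ for $\mu$-a.e. $\theta$. -/

import Mathlib

open MeasureTheory ProbabilityTheory InformationTheory
open scoped ENNReal

namespace StateCharacteristic

noncomputable section

variable {X Θ : Type*} [MeasurableSpace X] [MeasurableSpace Θ]

/-- The conditional law `P(dξ | θ)` of the characteristic given the state, a Markov kernel from
states to characteristics (a disintegration of the joint law `P` along `θ`). -/
def condCharacteristic [StandardBorelSpace X] [Nonempty X]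
    (P : ProbabilityMeasure (X × Θ)) : Kernel Θ X :=
  ((P : Measure (X × Θ)).map Prod.swap).condKernel

/-- The conditional law `P(dθ | ξ)` of the state given the characteristic. -/
def condState [StandardBorelSpace Θ] [Nonempty Θ]
    (P : ProbabilityMeasure (X × Θ)) : Kernel X Θ :=
  (P : Measure (X × Θ)).condKernel

/-- The average information gain relative to the prior `φ`:
`E_P[D_KL(P(ξ|θ) ‖ φ(ξ))]`, with values in `[0, ∞]`. -/
def verticalGain [StandardBorelSpace X] [Nonempty X] (φ : Measure X)
    (P : ProbabilityMeasure (X × Θ)) : ℝ≥0∞ :=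
  ∫⁻ θ, klDiv (condCharacteristic P θ) φ ∂((P : Measure (X × Θ)).snd)

/-- The Shannon information between characteristic and state:
`E_P[D_KL(P(θ|ξ) ‖ μ(θ))]`, with values in `[0, ∞]`. -/
def shannonGain [StandardBorelSpace Θ] [Nonempty Θ] (μ : Measure Θ)
    (P : ProbabilityMeasure (X × Θ)) : ℝ≥0∞ :=
  ∫⁻ ξ, klDiv (condState P ξ) μ ∂((P : Measure (X × Θ)).fst)

/-- The information cost
`κ_{α,λ}(P) = αλ E_P[D_KL(P(ξ|θ) ‖ φ)] + (1-α)λ E_P[D_KL(P(θ|ξ) ‖ μ)]`;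
the parameter `l` is the scale `λ`. -/
def cost [StandardBorelSpace X] [Nonempty X] [StandardBorelSpace Θ] [Nonempty Θ]
    (φ : Measure X) (μ : Measure Θ) (α l : ℝ) (P : ProbabilityMeasure (X × Θ)) : ℝ≥0∞ :=
  ENNReal.ofReal (α * l) * verticalGain φ P + ENNReal.ofReal ((1 - α) * l) * shannonGain μ P

/-- The objective `U(P) = E_P[u(ξ,θ)] - κ_{α,λ}(P)`, with values in `[-∞, ∞)`. -/
def objective [StandardBorelSpace X] [Nonempty X] [StandardBorelSpace Θ] [Nonempty Θ]
    (φ : Measure X) (μ : Measure Θ) (u : X → Θ → ℝ) (α l : ℝ)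
    (P : ProbabilityMeasure (X × Θ)) : EReal :=
  ((∫ z, u z.1 z.2 ∂(P : Measure (X × Θ)) : ℝ) : EReal) - (cost φ μ α l P : EReal)

/-- Bayes plausibility `P|_θ = μ` and marginal feasibility `P|_ξ ≪ φ`. -/
def Feasible (φ : Measure X) (μ : Measure Θ) (P : ProbabilityMeasure (X × Θ)) : Prop :=
  (P : Measure (X × Θ)).snd = μ ∧ (P : Measure (X × Θ)).fst ≪ φ

/-- `P` maximizes the objective over all feasible information policies. -/
def IsOptimal [StandardBorelSpace X] [Nonempty X] [StandardBorelSpace Θ] [Nonempty Θ]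
    (φ : Measure X) (μ : Measure Θ) (u : X → Θ → ℝ) (α l : ℝ)
    (P : ProbabilityMeasure (X × Θ)) : Prop :=
  Feasible φ μ P ∧
    ∀ Q : ProbabilityMeasure (X × Θ), Feasible φ μ Q →
      objective φ μ u α l Q ≤ objective φ μ u α l P

/-- `ν` is the characteristic marginal of some optimal information policy. -/
def IsOptimalMarginal [StandardBorelSpace X] [Nonempty X] [StandardBorelSpace Θ] [Nonempty Θ]
    (φ : Measure X) (μ : Measure Θ) (u : X → Θ → ℝ) (α l : ℝ) (ν : Measure X) : Prop :=
  ∃ P : ProbabilityMeasure (X × Θ), IsOptimal φ μ u α l P ∧ (P : Measure (X × Θ)).fst = ν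

/-- The Markov kernel `κ` is a version of the conditional choice probability `P(dξ | θ)` of some
optimal information policy `P`, i.e. `P(dξ, dθ) = κ(θ, dξ) P|_θ(dθ)`. -/
def IsOptimalCCP [StandardBorelSpace X] [Nonempty X] [StandardBorelSpace Θ] [Nonempty Θ]
    (φ : Measure X) (μ : Measure Θ) (u : X → Θ → ℝ) (α l : ℝ) (κ : Kernel Θ X) : Prop :=
  IsMarkovKernel κ ∧ ∃ P : ProbabilityMeasure (X × Θ), IsOptimal φ μ u α l P ∧
    (((P : Measure (X × Θ)).snd).compProd κ).map Prod.swap = (P : Measure (X × Θ))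

end

end StateCharacteristic

/-! By the chain rule for relative entropy, the two expected gains of a feasible `P` are the
divergences of `P` from `φ ⊗ μ` and from `P|_ξ ⊗ μ`. With `αλ > 0`, finite cost forces `P ≪ φ ⊗ μ`,
so the problem becomes the minimization of a nonnegative integral functional, `loss`, over joint
densities `f` with state marginal `μ`. The product `φ ⊗ μ` has zero cost, so the infimum is finite.

The loss is the sum of a linear payoff term, `αλ ∫ klFun f`, and the jointly convex term `b klFun (f
/ b)`, where `b` is the characteristic marginal density. The middle term is quantitatively convex:
averaging two densities gains a multiple of their squared Hellinger distance
(`klFun_midpoint_add_le`). Hence two minimizers coincide almost everywhere. The same estimate makes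
every minimizing sequence Cauchy in Hellinger distance, therefore in `L¹`, so no weak compactness is
required: completeness gives a limit, the constraint on the state marginal survives, and Fatou's
lemma shows that the limit is a minimizer (`lintegral_sq_sqrt_sub_le`, `exists_isMin_loss`). -/

/-! ### Relative entropy: disintegration and densities. -/

theorem InformationTheory.klDiv_compProd_right_eq_lintegral {α β : Type*} [MeasurableSpace α]
    [MeasurableSpace β] [MeasurableSpace.CountableOrCountablyGenerated α β]
    (ν : Measure α) [IsFiniteMeasure ν]
    (κ η : Kernel α β) [IsFiniteKernel κ] [IsFiniteKernel η] :
    klDiv (ν ⊗ₘ κ) (ν ⊗ₘ η) = ∫⁻ a, klDiv (κ a) (η a) ∂ν := by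
  by_cases hac : ∀ᵐ a ∂ν, κ a ≪ η a
  · have hκ : ∀ᵐ a ∂ν, κ a = η.withDensity (κ.rnDeriv η) a := by
      filter_upwards [hac] with a ha using (Kernel.withDensity_rnDeriv_eq ha).symm
    have hmeas : Measurable (fun p : α × β => κ.rnDeriv η p.1 p.2) := by fun_prop
    -- The fibrewise density is also the joint density, so both sides integrate the same `klFun`.
    have hd : ν ⊗ₘ κ = (ν ⊗ₘ η).withDensity (fun p => κ.rnDeriv η p.1 p.2) := by
      rw [Measure.compProd_congr hκ, Measure.compProd_withDensity (by fun_prop)]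
    have hac' : ν ⊗ₘ κ ≪ ν ⊗ₘ η := by
      rw [hd]; exact withDensity_absolutelyContinuous _ _
    have hr : (ν ⊗ₘ κ).rnDeriv (ν ⊗ₘ η) =ᵐ[ν ⊗ₘ η] fun p => κ.rnDeriv η p.1 p.2 := by
      rw [hd]; exact Measure.rnDeriv_withDensity _ hmeas
    rw [klDiv_eq_lintegral_klFun_of_ac hac',
      lintegral_congr_ae (hr.mono fun p hp => by rw [hp]),
      Measure.lintegral_compProd (by fun_prop)]
    refine lintegral_congr_ae ?_
    filter_upwards [hac] with a ha
    rw [klDiv_eq_lintegral_klFun_of_ac ha]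
    refine lintegral_congr_ae ?_
    filter_upwards [κ.rnDeriv_eq_rnDeriv_measure (η := η) (a := a)] with b hb
    simp only [hb]
  -- Both sides are infinite: the integrand on the right is `⊤` on a set of positive measure.
  · rw [klDiv_of_not_ac fun h => hac h.kernel_of_compProd]
    set s := {a | κ a ≪ η a} with hs
    have hsm : MeasurableSet s := Kernel.measurableSet_absolutelyContinuous κ η
    have hpos : ν sᶜ ≠ 0 := fun h => hac (measure_eq_zero_iff_ae_notMem.1 h |>.mono
      fun a ha => by simpa [hs] using ha)
    refine (top_le_iff.1 ?_).symm
    calc (⊤ : ℝ≥0∞) = ∫⁻ a, sᶜ.indicator (fun _ => ⊤) a ∂ν := by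
          rw [lintegral_indicator hsm.compl, setLIntegral_const, ENNReal.top_mul hpos]
      _ ≤ ∫⁻ a, klDiv (κ a) (η a) ∂ν := by
          refine lintegral_mono fun a => ?_
          by_cases ha : a ∈ s
          · simp [ha]
          · rw [klDiv_of_not_ac ha]; exact le_top

theorem InformationTheory.klDiv_withDensity_ofReal {α : Type*} [MeasurableSpace α] (ρ : Measure α)
    [IsFiniteMeasure ρ] {f g : α → ℝ} (hf : Measurable f) (hg : Measurable g)
    (hg0 : ∀ x, 0 ≤ g x) (hfg : ∀ᵐ x ∂ρ, g x = 0 → f x = 0) (hf0 : ∀ x, 0 ≤ f x)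
    [IsFiniteMeasure (ρ.withDensity fun x => ENNReal.ofReal (f x))]
    [IsFiniteMeasure (ρ.withDensity fun x => ENNReal.ofReal (g x))] :
    klDiv (ρ.withDensity fun x => ENNReal.ofReal (f x))
        (ρ.withDensity fun x => ENNReal.ofReal (g x)) =
      ∫⁻ x, ENNReal.ofReal (g x * klFun (f x / g x)) ∂ρ := by
  have hd : (ρ.withDensity fun x => ENNReal.ofReal (f x)) =
      (ρ.withDensity fun x => ENNReal.ofReal (g x)).withDensity
        (fun x => ENNReal.ofReal (f x / g x)) := by
    rw [← withDensity_mul _ (by fun_prop) (by fun_prop)]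
    refine withDensity_congr_ae ?_
    filter_upwards [hfg] with x hx
    rw [Pi.mul_apply, ← ENNReal.ofReal_mul (hg0 x)]
    by_cases h : g x = 0
    · simp [h, hx h]
    · rw [mul_div_cancel₀ _ h]
  have hac := withDensity_absolutelyContinuous (ρ.withDensity fun x => ENNReal.ofReal (g x))
    (fun x => ENNReal.ofReal (f x / g x))
  have hr := Measure.rnDeriv_withDensity (ρ.withDensity fun x => ENNReal.ofReal (g x))
    (f := fun x => ENNReal.ofReal (f x / g x)) (by fun_prop)
  rw [← hd] at hac hr
  rw [klDiv_eq_lintegral_klFun_of_ac hac,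
    lintegral_congr_ae (hr.mono fun p hp => by rw [hp]),
    lintegral_withDensity_eq_lintegral_mul _ (by fun_prop) (by fun_prop)]
  refine lintegral_congr fun x => ?_
  rw [Pi.mul_apply, ← ENNReal.ofReal_mul (hg0 x),
    ENNReal.toReal_ofReal (div_nonneg (hf0 x) (hg0 x))]

/-! ### Scalar convexity inequalities. -/

namespace InformationTheory

/-- This is `log t ≤ t - 1` at `t = √m / √a`; the square root is what later produces the Hellinger
distance. -/
theorem mul_log_add_le_klFun {a m : ℝ} (ha : 0 ≤ a) (hm : 0 < m) :
    a * Real.log m + a + 1 - 2 * (√a * √m) ≤ klFun a := by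
  rw [klFun_apply]
  obtain rfl | ha := ha.eq_or_lt
  · simp
  have hsa : 0 < √a := Real.sqrt_pos.2 ha
  have hsm : 0 < √m := Real.sqrt_pos.2 hm
  have h := Real.log_le_sub_one_of_pos (div_pos hsm hsa)
  rw [Real.log_div hsm.ne' hsa.ne', Real.log_sqrt hm.le, Real.log_sqrt ha.le] at h
  have h2 := mul_le_mul_of_nonneg_left h ha.le
  have h3 : a * (√m / √a) = √a * √m := by
    nth_rw 1 [← Real.mul_self_sqrt ha.le]
    field_simp
  rw [mul_sub, mul_sub, h3] at h2
  linarith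

theorem klFun_midpoint_add_le {a b : ℝ} (ha : 0 ≤ a) (hb : 0 ≤ b) :
    2 * klFun ((a + b) / 2) + (√a - √b) ^ 2 / 2 ≤ klFun a + klFun b := by
  obtain hm | hm := eq_or_lt_of_le (show 0 ≤ (a + b) / 2 by positivity)
  · obtain rfl : a = 0 := by linarith
    obtain rfl : b = 0 := by linarith
    norm_num [klFun_zero]
  have h1 := mul_log_add_le_klFun ha hm
  have h2 := mul_log_add_le_klFun hb hm
  rw [klFun_apply ((a + b) / 2)]
  have e1 := Real.sq_sqrt ha
  have e2 := Real.sq_sqrt hb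
  have e3 := Real.sq_sqrt hm.le
  -- After adding `h1` and `h2`, the remaining slack is exactly half of this square.
  nlinarith [sq_nonneg (2 * √((a + b) / 2) - (√a + √b))]

/-- The perspective of a convex function is jointly convex: apply convexity of `klFun` with weights
`b / (b + b')` and `b' / (b + b')`. Hypotheses `h` and `h'` keep `b * (a / b) = a` true when `b =
0`. -/
theorem mul_klFun_div_midpoint_le {a a' b b' : ℝ} (ha : 0 ≤ a) (ha' : 0 ≤ a') (hb : 0 ≤ b)
    (hb' : 0 ≤ b') (h : b = 0 → a = 0) (h' : b' = 0 → a' = 0) :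
    2 * ((b + b') / 2 * klFun ((a + a') / 2 / ((b + b') / 2))) ≤
      b * klFun (a / b) + b' * klFun (a' / b') := by
  obtain hn | hn := eq_or_lt_of_le (show 0 ≤ (b + b') by positivity)
  · obtain rfl : b = 0 := by linarith
    obtain rfl : b' = 0 := by linarith
    simp
  have key := convexOn_klFun.2 (Set.mem_Ici.2 (div_nonneg ha hb))
    (Set.mem_Ici.2 (div_nonneg ha' hb')) (show 0 ≤ b / (b + b') by positivity)
    (show 0 ≤ b' / (b + b') by positivity) (by field_simp)
  simp only [smul_eq_mul] at key
  have e : b / (b + b') * (a / b) + b' / (b + b') * (a' / b') = (a + a') / 2 / ((b + b') / 2) := by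
    have e1 : b * (a / b) = a := by
      by_cases hb0 : b = 0
      · simp [hb0, h hb0]
      · field_simp
    have e2 : b' * (a' / b') = a' := by
      by_cases hb0 : b' = 0
      · simp [hb0, h' hb0]
      · field_simp
    rw [div_mul_eq_mul_div, e1, div_mul_eq_mul_div, e2]
    field_simp
  rw [e] at key
  have := mul_le_mul_of_nonneg_left key hn.le
  calc _ = (b + b') * klFun ((a + a') / 2 / ((b + b') / 2)) := by ring
    _ ≤ _ := this
    _ = _ := by field_simp

end InformationTheory

/-- Factor `a - b = (√a - √b)(√a + √b)` and apply Young's inequality with parameter `ε`. -/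
theorem abs_sub_le_sq_sqrt_sub_add {a b ε : ℝ} (ha : 0 ≤ a) (hb : 0 ≤ b) (hε : 0 < ε) :
    |a - b| ≤ 1 / (2 * ε) * (√a - √b) ^ 2 + ε * (a + b) := by
  have e1 := Real.sq_sqrt ha
  have e2 := Real.sq_sqrt hb
  set p := √a
  set q := √b
  have hp : 0 ≤ p := Real.sqrt_nonneg _
  have hq : 0 ≤ q := Real.sqrt_nonneg _
  have e3 : |a - b| = |p - q| * (p + q) := by
    rw [← e1, ← e2, sq_sub_sq, abs_mul, abs_of_nonneg (add_nonneg hp hq), mul_comm]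
  have e4 : |p - q| ^ 2 = (p - q) ^ 2 := sq_abs _
  have e5 : (p + q) ^ 2 ≤ 2 * (a + b) := by nlinarith [sq_nonneg (p - q)]
  have e6 : 1 / (2 * ε) * (p - q) ^ 2 - |p - q| * (p + q) + ε / 2 * (p + q) ^ 2 =
      1 / (2 * ε) * (|p - q| - ε * (p + q)) ^ 2 := by
    rw [← e4]; field_simp; ring
  have e7 : 0 ≤ 1 / (2 * ε) * (|p - q| - ε * (p + q)) ^ 2 := by positivity
  rw [e3]
  nlinarith

/-! ### The information gains as divergences of the joint law. -/

namespace StateCharacteristic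

section Gains

variable {X Θ : Type*} [MeasurableSpace X] [MeasurableSpace Θ]

theorem shannonGain_eq_klDiv [StandardBorelSpace Θ] [Nonempty Θ] (μ : Measure Θ)
    [IsFiniteMeasure μ] [MeasurableSpace.CountableOrCountablyGenerated X Θ]
    (P : ProbabilityMeasure (X × Θ)) :
    shannonGain μ P = klDiv (P : Measure (X × Θ)) ((P : Measure (X × Θ)).fst.prod μ) := by
  have h := klDiv_compProd_right_eq_lintegral (P : Measure (X × Θ)).fst
    (P : Measure (X × Θ)).condKernel (Kernel.const X μ)
  rw [Measure.disintegrate, Measure.compProd_const] at h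
  rw [h]
  simp only [shannonGain, condState, Kernel.const_apply]

theorem verticalGain_eq_klDiv [StandardBorelSpace X] [Nonempty X] (φ : Measure X)
    [IsFiniteMeasure φ] [MeasurableSpace.CountableOrCountablyGenerated Θ X]
    (P : ProbabilityMeasure (X × Θ)) :
    verticalGain φ P = klDiv (P : Measure (X × Θ)) (φ.prod (P : Measure (X × Θ)).snd) := by
  have h := klDiv_compProd_right_eq_lintegral ((P : Measure (X × Θ)).map Prod.swap).fst
    ((P : Measure (X × Θ)).map Prod.swap).condKernel (Kernel.const Θ φ)
  rw [Measure.disintegrate, Measure.compProd_const, Measure.fst_map_swap] at h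
  have h2 : klDiv ((P : Measure (X × Θ)).map Prod.swap) ((P : Measure (X × Θ)).snd.prod φ) =
      klDiv (P : Measure (X × Θ)) (φ.prod (P : Measure (X × Θ)).snd) := by
    apply le_antisymm
    · rw [← Measure.prod_swap (μ := φ)]
      exact klDiv_map_le _ _ measurable_swap
    · have := klDiv_map_le ((P : Measure (X × Θ)).map Prod.swap)
        ((P : Measure (X × Θ)).snd.prod φ) measurable_swap
      rwa [Measure.prod_swap, Measure.map_map measurable_swap measurable_swap,
        Prod.swap_swap_eq, Measure.map_id] at this
  rw [← h2, h]
  simp only [verticalGain, condCharacteristic, Kernel.const_apply]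

end Gains

/-! ### Joint densities and the loss functional. -/

section Density

variable {X Θ : Type*} [MeasurableSpace X] [MeasurableSpace Θ]

/-- The characteristic marginal of a joint density. -/
noncomputable def marginalDensity (μ : Measure Θ) (f : X × Θ → ℝ) (ξ : X) : ℝ :=
  (∫⁻ θ, ENNReal.ofReal (f (ξ, θ)) ∂μ).toReal

/-- The measure with density `f` with respect to the product of the priors. -/
noncomputable def densityMeasure (φ : Measure X) (μ : Measure Θ) (f : X × Θ → ℝ) :
    Measure (X × Θ) :=
  (φ.prod μ).withDensity fun z => ENNReal.ofReal (f z)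

/-- `f` is the density of a joint law whose state marginal is `μ`. -/
structure IsPolicyDensity (φ : Measure X) (μ : Measure Θ) (f : X × Θ → ℝ) : Prop where
  measurable : Measurable f
  nonneg : ∀ z, 0 ≤ f z
  snd_eq : (densityMeasure φ μ f).snd = μ

theorem marginalDensity_nonneg {X : Type*} (μ : Measure Θ) (f : X × Θ → ℝ) (ξ : X) :
    0 ≤ marginalDensity μ f ξ := ENNReal.toReal_nonneg

variable {φ : Measure X} {μ : Measure Θ} {f g : X × Θ → ℝ}

theorem IsPolicyDensity.isProbabilityMeasure [IsProbabilityMeasure μ]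
    (hf : IsPolicyDensity φ μ f) : IsProbabilityMeasure (densityMeasure φ μ f) :=
  ⟨by rw [← Measure.snd_univ, hf.snd_eq, measure_univ]⟩

theorem IsPolicyDensity.lintegral_eq_one [IsProbabilityMeasure μ]
    (hf : IsPolicyDensity φ μ f) : ∫⁻ z, ENNReal.ofReal (f z) ∂(φ.prod μ) = 1 := by
  have := hf.isProbabilityMeasure.measure_univ
  rwa [densityMeasure, withDensity_apply _ .univ, Measure.restrict_univ] at this

variable [IsProbabilityMeasure φ] [IsProbabilityMeasure μ]

@[fun_prop]
theorem measurable_marginalDensity (hf : Measurable f) : Measurable (marginalDensity μ f) :=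
  (hf.ennreal_ofReal.lintegral_prod_right').ennreal_toReal

theorem isPolicyDensity_one : IsPolicyDensity φ μ fun _ => 1 where
  measurable := by fun_prop
  nonneg _ := zero_le_one
  snd_eq := by simp [densityMeasure]

namespace IsPolicyDensity

theorem ae_ofReal_marginalDensity (hf : IsPolicyDensity φ μ f) :
    ∀ᵐ ξ ∂φ, ENNReal.ofReal (marginalDensity μ f ξ) = ∫⁻ θ, ENNReal.ofReal (f (ξ, θ)) ∂μ := by
  have h := hf.lintegral_eq_one
  rw [lintegral_prod _ hf.measurable.ennreal_ofReal.aemeasurable] at h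
  have hfin := ae_lt_top (hf.measurable.ennreal_ofReal.lintegral_prod_right')
    (h.trans_ne ENNReal.one_ne_top)
  filter_upwards [hfin] with ξ hξ using ENNReal.ofReal_toReal hξ.ne

theorem fst_eq (hf : IsPolicyDensity φ μ f) : (densityMeasure φ μ f).fst =
    φ.withDensity fun ξ => ENNReal.ofReal (marginalDensity μ f ξ) := by
  ext s hs
  rw [Measure.fst_apply hs, densityMeasure, withDensity_apply _ (measurable_fst hs),
    withDensity_apply _ hs, ← Set.prod_univ,
    setLIntegral_prod _ hf.measurable.ennreal_ofReal.aemeasurable, Measure.restrict_univ]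
  exact lintegral_congr_ae (ae_restrict_of_ae <| hf.ae_ofReal_marginalDensity.mono
    fun ξ h => h.symm)

theorem fst_prod_eq (hf : IsPolicyDensity φ μ f) : (densityMeasure φ μ f).fst.prod μ =
    densityMeasure φ μ fun z => marginalDensity μ f z.1 := by
  have := hf.measurable
  rw [hf.fst_eq, prod_withDensity_left (by fun_prop), densityMeasure]

/-- A nonnegative fibre with zero integral vanishes almost everywhere. This makes the quotient `f /
b` harmless where Lean sets it to `0`. -/
theorem ae_eq_zero_of_marginalDensity_eq_zero (hf : IsPolicyDensity φ μ f) :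
    ∀ᵐ z ∂(φ.prod μ), marginalDensity μ f z.1 = 0 → f z = 0 := by
  have hm := hf.measurable
  have hs : MeasurableSet {z : X × Θ | marginalDensity μ f z.1 = 0 → f z = 0} := by
    have : {z : X × Θ | marginalDensity μ f z.1 = 0 → f z = 0} =
        {z | marginalDensity μ f z.1 = 0}ᶜ ∪ {z | f z = 0} := by
      ext z; simp [imp_iff_not_or]
    rw [this]
    exact ((measurableSet_eq_fun (by fun_prop) measurable_const).compl).union
      (measurableSet_eq_fun hm measurable_const)
  rw [Measure.ae_prod_iff_ae_ae hs]
  filter_upwards [hf.ae_ofReal_marginalDensity] with ξ hξ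
  by_cases h : marginalDensity μ f ξ = 0
  · rw [h, ENNReal.ofReal_zero, eq_comm, lintegral_eq_zero_iff (by fun_prop)] at hξ
    filter_upwards [hξ] with θ hθ _
    exact le_antisymm (ENNReal.ofReal_eq_zero.1 hθ) (hf.nonneg _)
  · exact .of_forall fun θ h' => absurd h' h

theorem klDiv_prod (hf : IsPolicyDensity φ μ f) :
    klDiv (densityMeasure φ μ f) (φ.prod μ) =
      ∫⁻ z, ENNReal.ofReal (klFun (f z)) ∂(φ.prod μ) := by
  have := hf.isProbabilityMeasure
  unfold densityMeasure at this
  have h1 : (φ.prod μ).withDensity (fun _ => ENNReal.ofReal 1) = φ.prod μ := by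
    simp
  have : IsFiniteMeasure ((φ.prod μ).withDensity (fun _ => ENNReal.ofReal 1)) := by
    rw [h1]; infer_instance
  have h := klDiv_withDensity_ofReal (φ.prod μ) hf.measurable (g := fun _ => (1 : ℝ))
    (by fun_prop) (by simp) (by simp) hf.nonneg
  rw [h1] at h
  rw [densityMeasure, h]
  simp

theorem klDiv_fst_prod (hf : IsPolicyDensity φ μ f) :
    klDiv (densityMeasure φ μ f) ((densityMeasure φ μ f).fst.prod μ) =
      ∫⁻ z, ENNReal.ofReal (marginalDensity μ f z.1 * klFun (f z / marginalDensity μ f z.1))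
        ∂(φ.prod μ) := by
  have := hf.isProbabilityMeasure
  have hm := hf.measurable
  have : IsProbabilityMeasure (densityMeasure φ μ fun z => marginalDensity μ f z.1) := by
    rw [← hf.fst_prod_eq]; infer_instance
  rw [hf.fst_prod_eq]
  unfold densityMeasure at *
  exact klDiv_withDensity_ofReal (φ.prod μ) hf.measurable (by fun_prop)
    (fun z => marginalDensity_nonneg _ _ _) hf.ae_eq_zero_of_marginalDensity_eq_zero hf.nonneg

end IsPolicyDensity

theorem exists_isPolicyDensity {P : Measure (X × Θ)} [IsFiniteMeasure P] (hs : P.snd = μ)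
    (hac : P ≪ φ.prod μ) : ∃ f, IsPolicyDensity φ μ f ∧ densityMeasure φ μ f = P := by
  have h : densityMeasure φ μ (fun z => (P.rnDeriv (φ.prod μ) z).toReal) = P := by
    conv_rhs => rw [← Measure.withDensity_rnDeriv_eq P _ hac]
    refine withDensity_congr_ae ?_
    filter_upwards [P.rnDeriv_lt_top (φ.prod μ)] with z hz using ENNReal.ofReal_toReal hz.ne
  exact ⟨_, ⟨by fun_prop, fun _ => ENNReal.toReal_nonneg, by rw [h, hs]⟩, h⟩

/-- The integrand of the loss: `w` is the forgone payoff, `a` the joint density, `b` the marginal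
density. -/
noncomputable def lossIntegrand (A B w a b : ℝ) : ℝ :=
  w * a + A * klFun a + B * (b * klFun (a / b))

/-- The forgone payoff plus the information cost of the joint density `f`. -/
noncomputable def loss (φ : Measure X) (μ : Measure Θ) (w : X × Θ → ℝ) (A B : ℝ)
    (f : X × Θ → ℝ) : ℝ≥0∞ :=
  ∫⁻ z, ENNReal.ofReal (lossIntegrand A B (w z) (f z) (marginalDensity μ f z.1)) ∂(φ.prod μ)

theorem loss_eq {A B : ℝ} (hA : 0 ≤ A) (hB : 0 ≤ B) {w : X × Θ → ℝ} (hw : Measurable w)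
    (hw0 : ∀ z, 0 ≤ w z) (hf : IsPolicyDensity φ μ f) :
    loss φ μ w A B f = (∫⁻ z, ENNReal.ofReal (w z) ∂(densityMeasure φ μ f)) +
      (ENNReal.ofReal A * klDiv (densityMeasure φ μ f) (φ.prod μ) + ENNReal.ofReal B *
        klDiv (densityMeasure φ μ f) ((densityMeasure φ μ f).fst.prod μ)) := by
  have hm := hf.measurable
  rw [hf.klDiv_prod, hf.klDiv_fst_prod, densityMeasure,
    lintegral_withDensity_eq_lintegral_mul _ (by fun_prop) (by fun_prop),
    ← lintegral_const_mul _ (by fun_prop), ← lintegral_const_mul _ (by fun_prop),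
    ← lintegral_add_left (by fun_prop), ← lintegral_add_left (by fun_prop), loss]
  refine lintegral_congr fun z => ?_
  have h1 := hf.nonneg z
  have h2 := marginalDensity_nonneg μ f z.1
  have h3 := klFun_nonneg h1
  have h4 := mul_nonneg h2 (klFun_nonneg (div_nonneg h1 h2))
  rw [lossIntegrand, ENNReal.ofReal_add (add_nonneg (mul_nonneg (hw0 z) h1) (mul_nonneg hA h3))
    (mul_nonneg hB h4), ENNReal.ofReal_add (mul_nonneg (hw0 z) h1) (mul_nonneg hA h3),
    ENNReal.ofReal_mul hA, ENNReal.ofReal_mul hB, Pi.mul_apply, mul_comm (w z),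
    ENNReal.ofReal_mul h1, add_assoc]

end Density

end StateCharacteristic

/-! ### Convexity, semicontinuity and `L¹` estimates. -/

namespace StateCharacteristic

section Density
open Filter Topology

variable {X Θ : Type*} [MeasurableSpace X] [MeasurableSpace Θ]
variable {φ : Measure X} {μ : Measure Θ} {f g : X × Θ → ℝ}

theorem lossIntegrand_midpoint_add_le {A B w a a' b b' : ℝ} (hA : 0 ≤ A) (hB : 0 ≤ B)
    (ha : 0 ≤ a) (ha' : 0 ≤ a') (hb : 0 ≤ b) (hb' : 0 ≤ b') (h : b = 0 → a = 0)
    (h' : b' = 0 → a' = 0) :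
    2 * lossIntegrand A B w ((a + a') / 2) ((b + b') / 2) + A / 2 * (√a - √a') ^ 2 ≤
      lossIntegrand A B w a b + lossIntegrand A B w a' b' := by
  have h1 := mul_le_mul_of_nonneg_left (klFun_midpoint_add_le ha ha') hA
  have h2 := mul_le_mul_of_nonneg_left (mul_klFun_div_midpoint_le ha ha' hb hb' h h') hB
  unfold lossIntegrand
  linarith

theorem lossIntegrand_nonneg {A B w a b : ℝ} (hA : 0 ≤ A) (hB : 0 ≤ B) (hw : 0 ≤ w) (ha : 0 ≤ a)
    (hb : 0 ≤ b) : 0 ≤ lossIntegrand A B w a b :=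
  add_nonneg (add_nonneg (mul_nonneg hw ha) (mul_nonneg hA (klFun_nonneg ha)))
    (mul_nonneg hB (mul_nonneg hb (klFun_nonneg (div_nonneg ha hb))))

theorem lossIntegrand_le_liminf {A B w a b : ℝ} (hB : 0 ≤ B) {s t : ℕ → ℝ}
    (hs : Tendsto s atTop (𝓝 a)) (ht : Tendsto t atTop (𝓝 b)) (hs0 : ∀ n, 0 ≤ s n)
    (ht0 : ∀ n, 0 ≤ t n) :
    ENNReal.ofReal (lossIntegrand A B w a b) ≤
      liminf (fun n => ENNReal.ofReal (lossIntegrand A B w (s n) (t n))) atTop := by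
  have h1 : Tendsto (fun n => w * s n + A * klFun (s n)) atTop (𝓝 (w * a + A * klFun a)) :=
    (hs.const_mul w).add (((continuous_klFun.tendsto a).comp hs).const_mul A)
  -- The perspective term may jump at `b = 0`, but there its limiting value is `0` and the
  -- approximating terms are nonnegative, so it can be dropped.
  by_cases hb : b = 0
  · have e : lossIntegrand A B w a b = w * a + A * klFun a := by simp [lossIntegrand, hb]
    rw [e, ← (ENNReal.tendsto_ofReal h1).liminf_eq]
    refine liminf_le_liminf (.of_forall fun n => ENNReal.ofReal_le_ofReal ?_)
    exact le_add_of_nonneg_right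
      (mul_nonneg hB (mul_nonneg (ht0 n) (klFun_nonneg (div_nonneg (hs0 n) (ht0 n)))))
  · refine ((ENNReal.tendsto_ofReal (h1.add ?_)).liminf_eq).ge
    exact (ht.mul ((continuous_klFun.tendsto _).comp (hs.div ht hb))).const_mul B

theorem edist_marginalDensity_le {ξ : X} (hf : Measurable f) (hg : Measurable g)
    (h1 : ENNReal.ofReal (marginalDensity μ f ξ) = ∫⁻ θ, ENNReal.ofReal (f (ξ, θ)) ∂μ)
    (h2 : ENNReal.ofReal (marginalDensity μ g ξ) = ∫⁻ θ, ENNReal.ofReal (g (ξ, θ)) ∂μ) :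
    edist (marginalDensity μ f ξ) (marginalDensity μ g ξ) ≤
      ∫⁻ θ, edist (f (ξ, θ)) (g (ξ, θ)) ∂μ := by
  have key : ∀ {f g : X × Θ → ℝ}, Measurable g →
      ENNReal.ofReal (marginalDensity μ f ξ) = ∫⁻ θ, ENNReal.ofReal (f (ξ, θ)) ∂μ →
      ENNReal.ofReal (marginalDensity μ g ξ) = ∫⁻ θ, ENNReal.ofReal (g (ξ, θ)) ∂μ →
      ENNReal.ofReal (marginalDensity μ f ξ - marginalDensity μ g ξ) ≤
        ∫⁻ θ, edist (f (ξ, θ)) (g (ξ, θ)) ∂μ := by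
    intro f g hg h1 h2
    rw [ENNReal.ofReal_sub _ (marginalDensity_nonneg _ _ _), tsub_le_iff_left, h1, h2,
      ← lintegral_add_left (by fun_prop)]
    refine lintegral_mono fun θ => ?_
    rw [edist_dist, Real.dist_eq]
    refine (ENNReal.ofReal_le_ofReal ?_).trans ENNReal.ofReal_add_le
    linarith [le_abs_self (f (ξ, θ) - g (ξ, θ))]
  rw [edist_dist, Real.dist_eq]
  rcases abs_choice (marginalDensity μ f ξ - marginalDensity μ g ξ) with h | h <;> rw [h]
  · exact key hg h1 h2
  · rw [neg_sub]
    simp_rw [edist_comm (f _)]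
    exact key hf h2 h1

theorem IsPolicyDensity.midpoint (hf : IsPolicyDensity φ μ f) (hg : IsPolicyDensity φ μ g) :
    IsPolicyDensity φ μ fun z => (f z + g z) / 2 where
  measurable := (hf.measurable.add hg.measurable).div_const 2
  nonneg z := div_nonneg (add_nonneg (hf.nonneg z) (hg.nonneg z)) zero_le_two
  snd_eq := by
    have hfm := hf.measurable
    have hgm := hg.measurable
    have e : densityMeasure φ μ (fun z => (f z + g z) / 2) =
        ENNReal.ofReal (1 / 2) • (densityMeasure φ μ f + densityMeasure φ μ g) := by
      rw [densityMeasure, densityMeasure, densityMeasure, ← withDensity_add_left (by fun_prop),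
        ← withDensity_smul _ (by fun_prop)]
      congr 1
      ext z
      rw [Pi.smul_apply, Pi.add_apply, smul_eq_mul,
        ← ENNReal.ofReal_add (hf.nonneg _) (hg.nonneg _), ← ENNReal.ofReal_mul (by norm_num)]
      ring_nf
    rw [e, Measure.snd, Measure.map_smul, Measure.map_add _ _ measurable_snd]
    change ENNReal.ofReal (1 / 2) • ((densityMeasure φ μ f).snd + (densityMeasure φ μ g).snd) = μ
    rw [hf.snd_eq, hg.snd_eq, ← two_smul ℝ≥0∞ μ, smul_smul]
    rw [show ENNReal.ofReal (1 / 2) * 2 = 1 by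
      rw [← ENNReal.ofReal_ofNat 2, ← ENNReal.ofReal_mul (by norm_num)]; norm_num, one_smul]

variable [IsProbabilityMeasure φ] [IsProbabilityMeasure μ]

theorem marginalDensity_midpoint (hf : IsPolicyDensity φ μ f) (hg : IsPolicyDensity φ μ g) :
    ∀ᵐ z ∂(φ.prod μ), marginalDensity μ (fun z => (f z + g z) / 2) z.1 =
      (marginalDensity μ f z.1 + marginalDensity μ g z.1) / 2 := by
  have hfm := hf.measurable
  have hgm := hg.measurable
  refine Measure.quasiMeasurePreserving_fst.ae (p := fun ξ =>
    marginalDensity μ (fun z => (f z + g z) / 2) ξ =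
      (marginalDensity μ f ξ + marginalDensity μ g ξ) / 2) ?_
  filter_upwards [hf.ae_ofReal_marginalDensity, hg.ae_ofReal_marginalDensity] with ξ h1 h2
  have e : ∀ θ, ENNReal.ofReal ((f (ξ, θ) + g (ξ, θ)) / 2) =
      ENNReal.ofReal (1 / 2) * (ENNReal.ofReal (f (ξ, θ)) + ENNReal.ofReal (g (ξ, θ))) := by
    intro θ
    rw [← ENNReal.ofReal_add (hf.nonneg _) (hg.nonneg _), ← ENNReal.ofReal_mul (by norm_num)]
    ring_nf
  rw [marginalDensity]
  simp_rw [e]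
  rw [lintegral_const_mul _ (by fun_prop), lintegral_add_left (by fun_prop), ← h1, ← h2,
    ← ENNReal.ofReal_add (marginalDensity_nonneg _ _ _) (marginalDensity_nonneg _ _ _),
    ← ENNReal.ofReal_mul (by norm_num), ENNReal.toReal_ofReal]
  · ring
  · have := marginalDensity_nonneg μ f ξ
    have := marginalDensity_nonneg μ g ξ
    positivity

theorem loss_midpoint_add_le {A B : ℝ} (hA : 0 ≤ A) (hB : 0 ≤ B) {w : X × Θ → ℝ}
    (hw : Measurable w) (hw0 : ∀ z, 0 ≤ w z)
    (hf : IsPolicyDensity φ μ f) (hg : IsPolicyDensity φ μ g) :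
    2 * loss φ μ w A B (fun z => (f z + g z) / 2) +
        ENNReal.ofReal (A / 2) * ∫⁻ z, ENNReal.ofReal ((√(f z) - √(g z)) ^ 2) ∂(φ.prod μ) ≤
      loss φ μ w A B f + loss φ μ w A B g := by
  have hfm := hf.measurable
  have hgm := hg.measurable
  have hL : ∀ {h : X × Θ → ℝ}, Measurable h → Measurable fun z =>
      ENNReal.ofReal (lossIntegrand A B (w z) (h z) (marginalDensity μ h z.1)) := by
    intro h hh; unfold lossIntegrand; fun_prop
  unfold loss
  rw [← lintegral_const_mul _ (hL (by fun_prop)), ← lintegral_const_mul _ (by fun_prop),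
    ← lintegral_add_right _ (by fun_prop), ← lintegral_add_left (hL hfm)]
  refine lintegral_mono_ae ?_
  filter_upwards [marginalDensity_midpoint hf hg, hf.ae_eq_zero_of_marginalDensity_eq_zero,
    hg.ae_eq_zero_of_marginalDensity_eq_zero] with z hz h1 h2
  have hmf := marginalDensity_nonneg μ f z.1
  have hmg := marginalDensity_nonneg μ g z.1
  have hf0 := hf.nonneg z
  have hg0 := hg.nonneg z
  rw [hz, ← ENNReal.ofReal_ofNat 2, ← ENNReal.ofReal_mul zero_le_two,
    ← ENNReal.ofReal_mul (by positivity), ← ENNReal.ofReal_add, ← ENNReal.ofReal_add]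
  · exact ENNReal.ofReal_le_ofReal
      (lossIntegrand_midpoint_add_le hA hB hf0 hg0 hmf hmg h1 h2)
  · exact lossIntegrand_nonneg hA hB (hw0 z) hf0 hmf
  · exact lossIntegrand_nonneg hA hB (hw0 z) hg0 hmg
  · exact mul_nonneg zero_le_two
      (lossIntegrand_nonneg hA hB (hw0 z) (by positivity) (by positivity))
  · positivity

/-- Hellinger closeness implies `L¹` closeness; the `2` is the total mass of the two densities. -/
theorem lintegral_edist_le {ε : ℝ} (hε : 0 < ε) (hf : IsPolicyDensity φ μ f)
    (hg : IsPolicyDensity φ μ g) :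
    ∫⁻ z, edist (f z) (g z) ∂(φ.prod μ) ≤ ENNReal.ofReal (1 / (2 * ε)) *
      (∫⁻ z, ENNReal.ofReal ((√(f z) - √(g z)) ^ 2) ∂(φ.prod μ)) + ENNReal.ofReal ε * 2 := by
  have hfm := hf.measurable
  have hgm := hg.measurable
  have e : (2 : ℝ≥0∞) =
      ∫⁻ z, (ENNReal.ofReal (f z) + ENNReal.ofReal (g z)) ∂(φ.prod μ) := by
    rw [lintegral_add_left (by fun_prop), hf.lintegral_eq_one, hg.lintegral_eq_one,
      one_add_one_eq_two]
  rw [e, ← lintegral_const_mul _ (by fun_prop), ← lintegral_const_mul _ (by fun_prop),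
    ← lintegral_add_left (by fun_prop)]
  refine lintegral_mono fun z => ?_
  have hf0 := hf.nonneg z
  have hg0 := hg.nonneg z
  rw [edist_dist, Real.dist_eq, ← ENNReal.ofReal_add hf0 hg0, ← ENNReal.ofReal_mul (by positivity),
    ← ENNReal.ofReal_mul hε.le, ← ENNReal.ofReal_add (by positivity) (by positivity)]
  exact ENNReal.ofReal_le_ofReal (abs_sub_le_sq_sqrt_sub_add hf0 hg0 hε)

theorem lintegral_edist_marginalDensity_le (hf : IsPolicyDensity φ μ f)
    (hg : IsPolicyDensity φ μ g) :
    ∫⁻ ξ, edist (marginalDensity μ f ξ) (marginalDensity μ g ξ) ∂φ ≤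
      ∫⁻ z, edist (f z) (g z) ∂(φ.prod μ) := by
  have hfm := hf.measurable
  have hgm := hg.measurable
  rw [lintegral_prod _ (by fun_prop)]
  refine lintegral_mono_ae ?_
  filter_upwards [hf.ae_ofReal_marginalDensity, hg.ae_ofReal_marginalDensity] with ξ h1 h2
    using edist_marginalDensity_le hfm hgm h1 h2

end Density

end StateCharacteristic

/-! ### Existence and uniqueness of the minimizing density. -/

namespace StateCharacteristic

section Density
open Filter Topology

variable {X Θ : Type*} [MeasurableSpace X] [MeasurableSpace Θ]
variable {φ : Measure X} {μ : Measure Θ} {f g : X × Θ → ℝ}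

/-- The integral over each set `Prod.snd ⁻¹' s` is `L¹`-continuous, so Bayes plausibility is a
closed condition. -/
theorem isPolicyDensity_of_tendsto {F : ℕ → X × Θ → ℝ} (hF : ∀ n, IsPolicyDensity φ μ (F n))
    (hf : Measurable f) (hf0 : ∀ z, 0 ≤ f z)
    (h : Tendsto (fun n => ∫⁻ z, edist (F n z) (f z) ∂(φ.prod μ)) atTop (𝓝 0)) :
    IsPolicyDensity φ μ f where
  measurable := hf
  nonneg := hf0
  snd_eq := by
    have key : ∀ {f g : X × Θ → ℝ}, Measurable f → Measurable g → ∀ s,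
        ∫⁻ z in s, ENNReal.ofReal (f z) ∂(φ.prod μ) ≤
          (∫⁻ z in s, ENNReal.ofReal (g z) ∂(φ.prod μ)) +
            ∫⁻ z, edist (f z) (g z) ∂(φ.prod μ) := by
      intro f g hf hg s
      refine le_trans ?_ (add_le_add_right (setLIntegral_le_lintegral s _) _)
      rw [← lintegral_add_left (by fun_prop)]
      refine lintegral_mono fun z => ?_
      rw [edist_dist, Real.dist_eq]
      refine (ENNReal.ofReal_le_ofReal ?_).trans ENNReal.ofReal_add_le
      linarith [le_abs_self (f z - g z)]
    ext s hs
    rw [Measure.snd_apply hs, densityMeasure, withDensity_apply _ (measurable_snd hs)]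
    have hFs : ∀ n, ∫⁻ z in Prod.snd ⁻¹' s, ENNReal.ofReal (F n z) ∂(φ.prod μ) = μ s := by
      intro n
      conv_rhs => rw [← (hF n).snd_eq]
      rw [Measure.snd_apply hs, densityMeasure, withDensity_apply _ (measurable_snd hs)]
    have hlim : Tendsto (fun n => μ s + ∫⁻ z, edist (F n z) (f z) ∂(φ.prod μ)) atTop (𝓝 (μ s)) := by
      simpa using h.const_add (μ s)
    have hlim' : Tendsto (fun n => (∫⁻ z in Prod.snd ⁻¹' s, ENNReal.ofReal (f z) ∂(φ.prod μ)) +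
        ∫⁻ z, edist (F n z) (f z) ∂(φ.prod μ)) atTop
        (𝓝 (∫⁻ z in Prod.snd ⁻¹' s, ENNReal.ofReal (f z) ∂(φ.prod μ))) := by
      simpa using h.const_add (∫⁻ z in Prod.snd ⁻¹' s, ENNReal.ofReal (f z) ∂(φ.prod μ))
    refine le_antisymm (ge_of_tendsto' hlim fun n => ?_) (ge_of_tendsto' hlim' fun n => ?_)
    · rw [← hFs n]
      simp_rw [edist_comm (F n _)]
      exact key hf (hF n).measurable _
    · rw [← hFs n]
      exact key (hF n).measurable hf _

variable [IsProbabilityMeasure φ] [IsProbabilityMeasure μ]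

theorem IsPolicyDensity.integrable (hf : IsPolicyDensity φ μ f) : Integrable f (φ.prod μ) := by
  refine ⟨hf.measurable.aestronglyMeasurable, ?_⟩
  rw [hasFiniteIntegral_iff_ofReal (.of_forall hf.nonneg), hf.lintegral_eq_one]
  exact ENNReal.one_lt_top

theorem exists_tendsto_of_cauchy {F : ℕ → X × Θ → ℝ} (hF : ∀ n, IsPolicyDensity φ μ (F n))
    (hC : ∀ ε : ℝ≥0∞, 0 < ε → ∃ N, ∀ m ≥ N, ∀ n ≥ N,
      ∫⁻ z, edist (F m z) (F n z) ∂(φ.prod μ) < ε) :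
    ∃ f, IsPolicyDensity φ μ f ∧
      Tendsto (fun n => ∫⁻ z, edist (F n z) (f z) ∂(φ.prod μ)) atTop (𝓝 0) := by
  have hc : CauchySeq fun n => (hF n).integrable.toL1 (F n) := by
    refine EMetric.cauchySeq_iff.2 fun ε hε => ?_
    obtain ⟨N, hN⟩ := hC ε hε
    exact ⟨N, fun m hm n hn => by rw [Integrable.edist_toL1_toL1]; exact hN m hm n hn⟩
  obtain ⟨G, hG⟩ := cauchySeq_tendsto_of_complete hc
  have hGm : Measurable G := (Lp.stronglyMeasurable G).measurable
  -- Truncating at `0` makes the representative nonnegative everywhere and, as `F n ≥ 0`, does not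
  -- increase the distance.
  have h : Tendsto (fun n => ∫⁻ z, edist (F n z) (max 0 (G z)) ∂(φ.prod μ)) atTop (𝓝 0) := by
    refine tendsto_of_tendsto_of_tendsto_of_le_of_le tendsto_const_nhds
      (tendsto_iff_edist_tendsto_0.1 hG) (fun _ => zero_le) fun n => ?_
    dsimp only
    rw [← Integrable.toL1_coeFn G (L1.integrable_coeFn G), Integrable.edist_toL1_toL1]
    refine lintegral_mono_ae ?_
    filter_upwards [(Integrable.coeFn_toL1 (L1.integrable_coeFn G))] with z hz
    rw [hz, edist_dist, edist_dist]
    refine ENNReal.ofReal_le_ofReal ?_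
    rw [Real.dist_eq, Real.dist_eq]
    have := abs_max_sub_max_le_abs (F n z) (G z) 0
    rwa [max_eq_left ((hF n).nonneg z), max_comm (G z)] at this
  exact ⟨_, isPolicyDensity_of_tendsto hF (by fun_prop) (fun z => le_max_left _ _) h, h⟩

theorem exists_subseq_tendsto_ae {F : ℕ → X × Θ → ℝ} (hF : ∀ n, IsPolicyDensity φ μ (F n))
    (hf : IsPolicyDensity φ μ f)
    (h : Tendsto (fun n => ∫⁻ z, edist (F n z) (f z) ∂(φ.prod μ)) atTop (𝓝 0)) :
    ∃ ns : ℕ → ℕ, StrictMono ns ∧ ∀ᵐ z ∂(φ.prod μ),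
      Tendsto (fun k => F (ns k) z) atTop (𝓝 (f z)) ∧
      Tendsto (fun k => marginalDensity μ (F (ns k)) z.1) atTop
        (𝓝 (marginalDensity μ f z.1)) := by
  have hfm := hf.measurable
  have hFm := fun n => (hF n).measurable
  -- Treating density and marginal as one pair yields a common subsequence for both.
  have hb : ∀ n, ∫⁻ z : X × Θ, edist (F n z, marginalDensity μ (F n) z.1)
      (f z, marginalDensity μ f z.1) ∂(φ.prod μ) ≤
      (∫⁻ z, edist (F n z) (f z) ∂(φ.prod μ)) + ∫⁻ z, edist (F n z) (f z) ∂(φ.prod μ) := by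
    intro n
    have hm : ∫⁻ z : X × Θ, edist (marginalDensity μ (F n) z.1) (marginalDensity μ f z.1)
        ∂(φ.prod μ) ≤ ∫⁻ z, edist (F n z) (f z) ∂(φ.prod μ) := by
      refine le_trans (le_of_eq ?_) (lintegral_edist_marginalDensity_le (hF n) hf)
      rw [lintegral_prod _ (by fun_prop)]
      simp
    refine le_trans ?_ (add_le_add_right hm _)
    rw [← lintegral_add_left (by fun_prop)]
    refine lintegral_mono fun z => ?_
    rw [Prod.edist_eq]
    exact max_le le_self_add le_add_self
  have hL : Tendsto (fun n => ∫⁻ z : X × Θ, edist (F n z, marginalDensity μ (F n) z.1)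
      (f z, marginalDensity μ f z.1) ∂(φ.prod μ)) atTop (𝓝 0) :=
    tendsto_of_tendsto_of_tendsto_of_le_of_le tendsto_const_nhds (by simpa using h.add h)
      (fun _ => zero_le) hb
  have hM : TendstoInMeasure (φ.prod μ) (fun n z => (F n z, marginalDensity μ (F n) z.1)) atTop
      (fun z => (f z, marginalDensity μ f z.1)) := by
    refine tendstoInMeasure_of_tendsto_eLpNorm one_ne_zero (fun n => ?_) ?_ ?_
    · exact Measurable.aestronglyMeasurable (by fun_prop)
    · exact Measurable.aestronglyMeasurable (by fun_prop)
    · refine hL.congr fun n => ?_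
      rw [eLpNorm_one_eq_lintegral_enorm]
      exact lintegral_congr fun z => edist_eq_enorm_sub _ _
  obtain ⟨ns, hns, hae⟩ := hM.exists_seq_tendsto_ae
  exact ⟨ns, hns, hae.mono fun z hz => (Prod.tendsto_iff _ _).1 hz⟩

theorem loss_le_of_tendsto {A B : ℝ} (hB : 0 ≤ B) {w : X × Θ → ℝ}
    (hw : Measurable w) {F : ℕ → X × Θ → ℝ} (hF : ∀ n, IsPolicyDensity φ μ (F n))
    (hf : IsPolicyDensity φ μ f)
    (h : Tendsto (fun n => ∫⁻ z, edist (F n z) (f z) ∂(φ.prod μ)) atTop (𝓝 0)) {c : ℝ≥0∞}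
    (hc : Tendsto (fun n => loss φ μ w A B (F n)) atTop (𝓝 c)) :
    loss φ μ w A B f ≤ c := by
  obtain ⟨ns, hns, hae⟩ := exists_subseq_tendsto_ae hF hf h
  have hFm := fun n => (hF n).measurable
  rw [← (hc.comp hns.tendsto_atTop).liminf_eq]
  refine le_trans (lintegral_mono_ae ?_) (lintegral_liminf_le fun n => ?_)
  · filter_upwards [hae] with z hz
    exact lossIntegrand_le_liminf hB hz.1 hz.2 (fun n => (hF _).nonneg z)
      (fun n => marginalDensity_nonneg _ _ _)
  · unfold lossIntegrand; fun_prop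

/-- The loss is strictly convex: two densities with almost minimal loss are close in
Hellinger distance. -/
theorem lintegral_sq_sqrt_sub_le {A B : ℝ} (hA : 0 ≤ A) (hB : 0 ≤ B) {w : X × Θ → ℝ}
    (hw : Measurable w) (hw0 : ∀ z, 0 ≤ w z) {m δ δ' : ℝ≥0∞} (hm : m ≠ ⊤)
    (hmin : ∀ h, IsPolicyDensity φ μ h → m ≤ loss φ μ w A B h)
    (hf : IsPolicyDensity φ μ f) (hg : IsPolicyDensity φ μ g)
    (hfm : loss φ μ w A B f ≤ m + δ) (hgm : loss φ μ w A B g ≤ m + δ') :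
    ENNReal.ofReal (A / 2) * ∫⁻ z, ENNReal.ofReal ((√(f z) - √(g z)) ^ 2) ∂(φ.prod μ) ≤
      δ + δ' := by
  have h := (loss_midpoint_add_le hA hB hw hw0 hf hg).trans (add_le_add hfm hgm)
  -- The midpoint is admissible, so its loss is at least `m`; finiteness of `m` then allows
  -- cancelling `2 * m`.
  have h2 := (add_le_add_left (mul_le_mul_right (hmin _ (hf.midpoint hg)) 2) _).trans h
  rw [show m + δ + (m + δ') = 2 * m + (δ + δ') by ring] at h2
  exact (ENNReal.add_le_add_iff_left (ENNReal.mul_ne_top ENNReal.ofNat_ne_top hm)).1 h2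

theorem ae_eq_of_isMin_loss {A B : ℝ} (hA : 0 < A) (hB : 0 ≤ B) {w : X × Θ → ℝ}
    (hw : Measurable w) (hw0 : ∀ z, 0 ≤ w z)
    (hf : IsPolicyDensity φ μ f) (hg : IsPolicyDensity φ μ g) (hfin : loss φ μ w A B f ≠ ⊤)
    (hmin : ∀ h, IsPolicyDensity φ μ h → loss φ μ w A B f ≤ loss φ μ w A B h)
    (hgf : loss φ μ w A B g ≤ loss φ μ w A B f) : f =ᵐ[φ.prod μ] g := by
  have hfm := hf.measurable
  have hgm := hg.measurable
  have h := lintegral_sq_sqrt_sub_le hA.le hB hw hw0 (δ := 0) (δ' := 0) hfin hmin hf hg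
    (by simp) (by simpa using hgf)
  rw [add_zero, nonpos_iff_eq_zero, mul_eq_zero, ENNReal.ofReal_eq_zero,
    lintegral_eq_zero_iff (by fun_prop)] at h
  replace h := h.resolve_left (by linarith)
  filter_upwards [h] with z hz
  have h1 := sq_nonneg (√(f z) - √(g z))
  have h2 := ENNReal.ofReal_eq_zero.1 hz
  have h3 := pow_eq_zero_iff two_ne_zero |>.1 (le_antisymm h2 h1)
  exact (Real.sqrt_inj (hf.nonneg z) (hg.nonneg z)).1 (sub_eq_zero.1 h3)

theorem exists_isMin_loss {A B : ℝ} (hA : 0 < A) (hB : 0 ≤ B) {w : X × Θ → ℝ}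
    (hw : Measurable w) (hw0 : ∀ z, 0 ≤ w z)
    (hfin : ∃ g, IsPolicyDensity φ μ g ∧ loss φ μ w A B g ≠ ⊤) :
    ∃ f, IsPolicyDensity φ μ f ∧ loss φ μ w A B f ≠ ⊤ ∧
      ∀ h, IsPolicyDensity φ μ h → loss φ μ w A B f ≤ loss φ μ w A B h := by
  set S := loss φ μ w A B '' {h | IsPolicyDensity φ μ h} with hS
  obtain ⟨g, hg, hgfin⟩ := hfin
  have hm : sInf S ≠ ⊤ := ne_top_of_le_ne_top hgfin (sInf_le ⟨g, hg, rfl⟩)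
  have hmin : ∀ h, IsPolicyDensity φ μ h → sInf S ≤ loss φ μ w A B h :=
    fun h hh => sInf_le ⟨h, hh, rfl⟩
  obtain ⟨v, -, hv, hvS⟩ := exists_seq_tendsto_sInf (S := S) ⟨_, g, hg, rfl⟩ (OrderBot.bddBelow S)
  choose F hF hFv using hvS
  have hd : Tendsto (fun n => v n - sInf S) atTop (𝓝 0) := by
    simpa using ENNReal.Tendsto.sub hv tendsto_const_nhds (.inr hm)
  have hH : ∀ k n, ∫⁻ z, ENNReal.ofReal ((√(F k z) - √(F n z)) ^ 2) ∂(φ.prod μ) ≤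
      (ENNReal.ofReal (A / 2))⁻¹ * ((v k - sInf S) + (v n - sInf S)) := by
    intro k n
    rw [← ENNReal.mul_le_iff_le_inv (by simpa using hA) ENNReal.ofReal_ne_top]
    exact lintegral_sq_sqrt_sub_le hA.le hB hw hw0 hm hmin (hF k) (hF n)
      (by rw [hFv]; exact le_add_tsub) (by rw [hFv]; exact le_add_tsub)
  obtain ⟨f, hf, hlim⟩ := exists_tendsto_of_cauchy hF fun ε hε => by
    -- Fix the Young parameter `η` first, so that the mass term is below `ε`; the Hellinger term
    -- then has a fixed finite factor `C` and tends to `0`.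
    obtain ⟨η, hη0, hη⟩ : ∃ η : ℝ, 0 < η ∧ ENNReal.ofReal η * 2 < ε := by
      have ht : Tendsto (fun η : ℝ => ENNReal.ofReal η * 2) (𝓝[>] 0) (𝓝 0) := by
        have : Tendsto (fun η : ℝ => ENNReal.ofReal η * 2) (𝓝 0) (𝓝 (ENNReal.ofReal 0 * 2)) :=
          ENNReal.Tendsto.mul_const (ENNReal.tendsto_ofReal tendsto_id) (.inr ENNReal.ofNat_ne_top)
        rw [ENNReal.ofReal_zero, zero_mul] at this
        exact this.mono_left nhdsWithin_le_nhds
      obtain ⟨η, h1, h2⟩ := ((ht.eventually_lt_const hε).and self_mem_nhdsWithin).exists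
      exact ⟨η, h2, h1⟩
    set C := ENNReal.ofReal (1 / (2 * η)) * (ENNReal.ofReal (A / 2))⁻¹ with hC
    have hCtop : C ≠ ⊤ := ENNReal.mul_ne_top ENNReal.ofReal_ne_top
      (ENNReal.inv_ne_top.2 (by simpa using hA))
    have ht : Tendsto (fun p : ℕ × ℕ => C * ((v p.1 - sInf S) + (v p.2 - sInf S)) +
        ENNReal.ofReal η * 2) atTop (𝓝 (C * (0 + 0) + ENNReal.ofReal η * 2)) := by
      rw [← prod_atTop_atTop_eq]
      exact (ENNReal.Tendsto.const_mul ((hd.comp tendsto_fst).add (hd.comp tendsto_snd))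
        (.inr hCtop)).add_const _
    have hev := ht.eventually_lt_const (u := ε) (by simpa using hη)
    obtain ⟨⟨N₁, N₂⟩, hN⟩ := eventually_atTop.1 hev
    refine ⟨max N₁ N₂, fun k hk n hn => lt_of_le_of_lt ?_ (hN (k, n)
      ⟨(le_max_left _ _).trans hk, (le_max_right _ _).trans hn⟩)⟩
    refine (lintegral_edist_le hη0 (hF k) (hF n)).trans (add_le_add_left ?_ _)
    rw [hC, mul_assoc]
    exact mul_le_mul_right (hH k n) _
  have hle : loss φ μ w A B f ≤ sInf S :=
    loss_le_of_tendsto hB hw hF hf hlim (by simpa only [hFv] using hv)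
  exact ⟨f, hf, ne_top_of_le_ne_top hm hle, fun h hh => hle.trans (hmin h hh)⟩

end Density

end StateCharacteristic

/-! ### From the objective to the loss. -/

namespace StateCharacteristic

section Feasible

variable {X Θ : Type*} [MeasurableSpace X] [MeasurableSpace Θ] {φ : Measure X} {μ : Measure Θ}
  [IsProbabilityMeasure φ] [IsProbabilityMeasure μ]

theorem IsPolicyDensity.feasible {f : X × Θ → ℝ} (hf : IsPolicyDensity φ μ f)
    {P : ProbabilityMeasure (X × Θ)} (hP : densityMeasure φ μ f = (P : Measure (X × Θ))) :
    Feasible φ μ P := by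
  refine ⟨by rw [← hP, hf.snd_eq], ?_⟩
  rw [← hP, hf.fst_eq]
  exact withDensity_absolutelyContinuous _ _

end Feasible

section Objective

variable {X Θ : Type*} [MeasurableSpace X] [MeasurableSpace Θ]
  [StandardBorelSpace X] [Nonempty X] [StandardBorelSpace Θ] [Nonempty Θ]
  {φ : Measure X} {μ : Measure Θ} {u : X → Θ → ℝ} {lo hi α l : ℝ}

/-- Measuring payoff as the shortfall from the upper bound `hi` makes everything subtracted
nonnegative, so maximizing in `EReal` becomes minimizing in `ℝ≥0∞`. -/
theorem objective_eq_sub (hu : Measurable (Function.uncurry u))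
    (hbd : ∀ ξ θ, u ξ θ ∈ Set.Icc lo hi) (P : ProbabilityMeasure (X × Θ)) :
    objective φ μ u α l P = (hi : EReal) -
      (((∫⁻ z, ENNReal.ofReal (hi - u z.1 z.2) ∂(P : Measure (X × Θ))) + cost φ μ α l P :
        ℝ≥0∞) : EReal) := by
  have hint : Integrable (fun z : X × Θ => u z.1 z.2) (P : Measure (X × Θ)) :=
    Integrable.of_mem_Icc lo hi hu.aemeasurable (.of_forall fun z => hbd z.1 z.2)
  have hint' : Integrable (fun z : X × Θ => hi - u z.1 z.2) (P : Measure (X × Θ)) :=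
    (integrable_const hi).sub hint
  have h0 : ∀ z : X × Θ, 0 ≤ hi - u z.1 z.2 := fun z => sub_nonneg.2 (hbd z.1 z.2).2
  rw [← ofReal_integral_eq_lintegral_ofReal hint' (.of_forall h0), objective]
  have hI : 0 ≤ ∫ z, (hi - u z.1 z.2) ∂(P : Measure (X × Θ)) := integral_nonneg h0
  have hI2 : ∫ z, u z.1 z.2 ∂(P : Measure (X × Θ)) =
      hi - ∫ z, (hi - u z.1 z.2) ∂(P : Measure (X × Θ)) := by
    rw [integral_sub (integrable_const hi) hint]
    simp
  rw [hI2]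
  generalize ∫ z, (hi - u z.1 z.2) ∂(P : Measure (X × Θ)) = I at hI
  obtain hc | hc := eq_or_ne (cost φ μ α l P) ⊤
  · rw [hc, add_top, EReal.coe_ennreal_top, EReal.sub_top, EReal.sub_top]
  · lift cost φ μ α l P to NNReal using hc with c
    rw [EReal.coe_ennreal_add, EReal.coe_ennreal_ofReal, max_eq_left hI,
      EReal.coe_nnreal_eq_coe_real]
    norm_cast
    ring

theorem coe_sub_coe_ennreal_le_iff (h : ℝ) (x y : ℝ≥0∞) :
    (h : EReal) - (x : EReal) ≤ (h : EReal) - (y : EReal) ↔ y ≤ x := by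
  induction x with
  | top => simp
  | coe x =>
    induction y with
    | top =>
      rw [EReal.coe_ennreal_top, EReal.sub_top, EReal.coe_nnreal_eq_coe_real, ← EReal.coe_sub]
      simp [-EReal.coe_sub]
    | coe y =>
      rw [EReal.coe_nnreal_eq_coe_real, EReal.coe_nnreal_eq_coe_real]
      norm_cast
      rw [sub_le_sub_iff_left]
      norm_cast

theorem objective_le_iff (hu : Measurable (Function.uncurry u))
    (hbd : ∀ ξ θ, u ξ θ ∈ Set.Icc lo hi) (P Q : ProbabilityMeasure (X × Θ)) :
    objective φ μ u α l Q ≤ objective φ μ u α l P ↔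
      (∫⁻ z, ENNReal.ofReal (hi - u z.1 z.2) ∂(P : Measure (X × Θ))) + cost φ μ α l P ≤
        (∫⁻ z, ENNReal.ofReal (hi - u z.1 z.2) ∂(Q : Measure (X × Θ))) + cost φ μ α l Q := by
  rw [objective_eq_sub hu hbd, objective_eq_sub hu hbd, coe_sub_coe_ennreal_le_iff]

theorem isOptimalCCP_condCharacteristic {P : ProbabilityMeasure (X × Θ)}
    (hP : IsOptimal φ μ u α l P) : IsOptimalCCP φ μ u α l (condCharacteristic P) := by
  refine ⟨by unfold condCharacteristic; infer_instance, P, hP, ?_⟩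
  rw [condCharacteristic, ← Measure.fst_map_swap, Measure.disintegrate,
    Measure.map_map measurable_swap measurable_swap, Prod.swap_swap_eq, Measure.map_id]

variable [IsProbabilityMeasure φ] [IsProbabilityMeasure μ]

theorem cost_eq (P : ProbabilityMeasure (X × Θ)) (hP : (P : Measure (X × Θ)).snd = μ) :
    cost φ μ α l P = ENNReal.ofReal (α * l) * klDiv (P : Measure (X × Θ)) (φ.prod μ) +
      ENNReal.ofReal ((1 - α) * l) *
        klDiv (P : Measure (X × Θ)) ((P : Measure (X × Θ)).fst.prod μ) := by
  rw [cost, verticalGain_eq_klDiv, shannonGain_eq_klDiv, hP]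

theorem lintegral_add_cost_eq_loss (hu : Measurable (Function.uncurry u))
    (hbd : ∀ ξ θ, u ξ θ ∈ Set.Icc lo hi) (hA : 0 ≤ α * l) (hB : 0 ≤ (1 - α) * l)
    {f : X × Θ → ℝ} (hf : IsPolicyDensity φ μ f) {P : ProbabilityMeasure (X × Θ)}
    (hP : densityMeasure φ μ f = (P : Measure (X × Θ))) :
    (∫⁻ z, ENNReal.ofReal (hi - u z.1 z.2) ∂(P : Measure (X × Θ))) + cost φ μ α l P =
      loss φ μ (fun z => hi - u z.1 z.2) (α * l) ((1 - α) * l) f := by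
  have hw : Measurable fun z : X × Θ => hi - u z.1 z.2 := measurable_const.sub hu
  rw [loss_eq hA hB hw (fun z => sub_nonneg.2 (hbd z.1 z.2).2) hf,
    cost_eq P (by rw [← hP, hf.snd_eq]), hP]

theorem exists_isPolicyDensity_of_cost_ne_top (hA : 0 < α * l) {P : ProbabilityMeasure (X × Θ)}
    (hP : Feasible φ μ P) (hc : cost φ μ α l P ≠ ⊤) :
    ∃ f, IsPolicyDensity φ μ f ∧ densityMeasure φ μ f = (P : Measure (X × Θ)) := by
  refine exists_isPolicyDensity hP.1 ?_
  by_contra h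
  apply hc
  rw [cost_eq P hP.1, klDiv_of_not_ac h, ENNReal.mul_top (by simpa using hA), top_add]

theorem loss_one_ne_top (hu : Measurable (Function.uncurry u))
    (hbd : ∀ ξ θ, u ξ θ ∈ Set.Icc lo hi) (hA : 0 ≤ α * l) (hB : 0 ≤ (1 - α) * l) :
    loss φ μ (fun z => hi - u z.1 z.2) (α * l) ((1 - α) * l) (fun _ => 1) ≠ ⊤ := by
  have h1 : densityMeasure φ μ (fun _ => 1) = φ.prod μ := by simp [densityMeasure]
  have hw : Measurable fun z : X × Θ => hi - u z.1 z.2 := measurable_const.sub hu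
  rw [loss_eq hA hB hw (fun z => sub_nonneg.2 (hbd z.1 z.2).2)
    isPolicyDensity_one, h1]
  simp only [Measure.fst_prod, klDiv_self, mul_zero, add_zero]
  refine ne_top_of_le_ne_top (b := ENNReal.ofReal (hi - lo)) ENNReal.ofReal_ne_top ?_
  refine (lintegral_mono fun z : X × Θ => ENNReal.ofReal_le_ofReal
    (sub_le_sub_left (hbd z.1 z.2).1 hi)).trans ?_
  simp

theorem existsUnique_isOptimal (hu : Measurable (Function.uncurry u))
    (hbd : ∀ ξ θ, u ξ θ ∈ Set.Icc lo hi) (hA : 0 < α * l) (hB : 0 ≤ (1 - α) * l) :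
    ∃! P : ProbabilityMeasure (X × Θ), IsOptimal φ μ u α l P := by
  have hw : Measurable fun z : X × Θ => hi - u z.1 z.2 := measurable_const.sub hu
  have hw0 : ∀ z : X × Θ, 0 ≤ hi - u z.1 z.2 := fun z => sub_nonneg.2 (hbd z.1 z.2).2
  obtain ⟨f, hf, hfin, hmin⟩ := exists_isMin_loss (φ := φ) (μ := μ) hA hB hw hw0
    ⟨_, isPolicyDensity_one, loss_one_ne_top hu hbd hA.le hB⟩
  set P : ProbabilityMeasure (X × Θ) := ⟨densityMeasure φ μ f, hf.isProbabilityMeasure⟩ with hPdef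
  have hP : densityMeasure φ μ f = (P : Measure (X × Θ)) := rfl
  refine ⟨P, ⟨hf.feasible hP, fun Q hQ => ?_⟩, fun Q hQ => ?_⟩
  · rw [objective_le_iff hu hbd]
    by_cases hc : cost φ μ α l Q = ⊤
    · rw [hc, add_top]
      exact le_top
    · obtain ⟨g, hg, hgQ⟩ := exists_isPolicyDensity_of_cost_ne_top hA hQ hc
      rw [lintegral_add_cost_eq_loss hu hbd hA.le hB hf hP,
        lintegral_add_cost_eq_loss hu hbd hA.le hB hg hgQ]
      exact hmin g hg
  · have hle := (objective_le_iff hu hbd _ _).1 (hQ.2 P (hf.feasible hP))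
    rw [lintegral_add_cost_eq_loss hu hbd hA.le hB hf hP] at hle
    -- An optimal `Q` does at least as well as `P`, whose loss is finite; hence `Q` has finite cost
    -- and a density.
    obtain ⟨g, hg, hgQ⟩ := exists_isPolicyDensity_of_cost_ne_top hA hQ.1
      (ne_top_of_le_ne_top hfin (le_add_self.trans hle))
    rw [lintegral_add_cost_eq_loss hu hbd hA.le hB hg hgQ] at hle
    have hfg := ae_eq_of_isMin_loss hA hB hw hw0 hf hg hfin hmin hle
    apply Subtype.ext
    change (Q : Measure (X × Θ)) = (P : Measure (X × Θ))
    rw [← hP, ← hgQ]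
    exact withDensity_congr_ae (hfg.mono fun z hz => by simp only [hz])

end Objective

end StateCharacteristic

/-! ### The main theorem. -/

theorem mainTheorem3 {X Θ : Type*}
    [TopologicalSpace X] [PolishSpace X] [MeasurableSpace X] [BorelSpace X] [Nonempty X]
    [TopologicalSpace Θ] [PolishSpace Θ] [MeasurableSpace Θ] [BorelSpace Θ] [Nonempty Θ]
    (φ : Measure X) [IsProbabilityMeasure φ] (μ : Measure Θ) [IsProbabilityMeasure μ]
    (u : X → Θ → ℝ) (hu : Measurable (Function.uncurry u))
    (lo hi : ℝ) (hbd : ∀ ξ θ, u ξ θ ∈ Set.Icc lo hi)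
    (α l : ℝ) (hα : α ∈ Set.Ioo (0 : ℝ) 1) (hl : 0 < l) :
    (∃! P : ProbabilityMeasure (X × Θ), StateCharacteristic.IsOptimal φ μ u α l P) ∧
    (∃! ν : Measure X, StateCharacteristic.IsOptimalMarginal φ μ u α l ν) ∧
    (∃ κ : Kernel Θ X, StateCharacteristic.IsOptimalCCP φ μ u α l κ) ∧
    (∀ κ κ' : Kernel Θ X, StateCharacteristic.IsOptimalCCP φ μ u α l κ →
      StateCharacteristic.IsOptimalCCP φ μ u α l κ' → ∀ᵐ θ ∂μ, κ θ = κ' θ) := by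
  have hA : 0 < α * l := mul_pos hα.1 hl
  have hB : 0 ≤ (1 - α) * l := mul_nonneg (sub_nonneg.2 hα.2.le) hl.le
  obtain ⟨P, hP, huniq⟩ :=
    StateCharacteristic.existsUnique_isOptimal (φ := φ) (μ := μ) hu hbd hA hB
  refine ⟨⟨P, hP, huniq⟩, ⟨_, ⟨P, hP, rfl⟩, ?_⟩,
    ⟨_, StateCharacteristic.isOptimalCCP_condCharacteristic hP⟩, ?_⟩
  · rintro _ ⟨Q, hQ, rfl⟩
    rw [huniq Q hQ]
  · rintro κ κ' ⟨hκ, Q, hQ, hκQ⟩ ⟨hκ', Q', hQ', hκQ'⟩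
    rw [huniq Q hQ, hP.1.1] at hκQ
    rw [huniq Q' hQ', hP.1.1] at hκQ'
    -- Both kernels disintegrate the same joint law over `μ`; undoing the swap reduces the claim to
    -- uniqueness of disintegration.
    have h := congrArg (Measure.map Prod.swap) (hκQ.trans hκQ'.symm)
    simp only [Measure.map_map measurable_swap measurable_swap, Prod.swap_swap_eq,
      Measure.map_id] at h
    exact Kernel.ae_eq_of_compProd_eq h
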